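/- Let $G$ be a finite simple graph on $n\ge 1$ vertices with degree sequence $d(G)=(d_1,\dots,d_n)$, let $L(G)$ be its Laplacian matrix (degree matrix minus adjacency matrix), and let $P_G(x)=\det(xI_n-L(G))$ be the characteristic polynomial of $L(G)$. For each positive integer $k$ put $$\ell_k(G)=\operatorname{tr}\bigl(L(G)^k\bigr),\qquad g_k(G)=\ell_k(G)-\sum_{i=1}^{n}d_i(d_i+1)^{k-1},$$ and for real $x\ge n$ put $$f(d(G),x)=\prod_{i=1}^{n}\left(1-\frac{d_i+1}{x}\right)^{\frac{d_i}{d_i+1}}$$ (a factor with $d_i=0$ equals $1$). Let $t(H)$ denote the number of spanning trees of a graph $H$, and let $\overline{G}$ be the complement of $G$. If $\overline{G}$ is connected, then for every positive integer $c$ and every real $x\ge n$, $$P_G(x)\le x^n\exp\left(-\sum_{k=1}^{c}\frac{g_k(G)}{k\,x^k}\right)f(d(G),x),$$ and moreover $$t(\overline{G})\le n^{n-2}\exp\left(-\sum_{k=1}^{c}\frac{g_k(G)}{k\,n^k}\right)f(d(G),n).$$ -/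

import Mathlib

noncomputable section

namespace GapBound

/-- The characteristic polynomial `P_G` of the Laplacian matrix of `G`. -/
def lapPoly {V : Type*} [Fintype V] [DecidableEq V] (G : SimpleGraph V) [DecidableRel G.Adj] :
    Polynomial ℝ :=
  (G.lapMatrix ℝ).charpoly

/-- The Laplacian sequence `ℓ_k(G) = tr (L(G)^k)`. -/
def lapSeq {V : Type*} [Fintype V] [DecidableEq V] (G : SimpleGraph V) [DecidableRel G.Adj]
    (k : ℕ) : ℝ :=
  ((G.lapMatrix ℝ) ^ k).trace

/-- The gap sequence `g_k(G) = ℓ_k(G) - ∑ v, d_v * (d_v + 1) ^ (k - 1)`,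
meant for positive integers `k`. -/
def gapSeq {V : Type*} [Fintype V] [DecidableEq V] (G : SimpleGraph V) [DecidableRel G.Adj]
    (k : ℕ) : ℝ :=
  lapSeq G k - ∑ v, (G.degree v : ℝ) * ((G.degree v : ℝ) + 1) ^ (k - 1)

/-- The function `f(d, x) = ∏ i, (1 - (d_i + 1) / x) ^ (d_i / (d_i + 1))` (real powers;
a factor with `d_i = 0` is `1`). -/
def degProd {V : Type*} [Fintype V] (d : V → ℕ) (x : ℝ) : ℝ :=
  ∏ i, (1 - ((d i : ℝ) + 1) / x) ^ ((d i : ℝ) / ((d i : ℝ) + 1))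

/-- The number of spanning trees of `H`: trees on the whole vertex set all of whose edges
are edges of `H`. -/
def numSpanningTrees {V : Type*} (H : SimpleGraph V) : ℕ :=
  Set.ncard {T : SimpleGraph V | T ≤ H ∧ T.IsTree}

end GapBound

end

/-! Since the complement is connected, the Laplacian eigenvalues `μ_j` lie in `[0, n)`. For `x ≥ n`
the logarithm series therefore gives `-log (P_G(x) / x^n) = ∑ ℓ_k / (k x^k)`. The same series with
`d_i + 1` in place of `μ_j`, weighted by `d_i / (d_i + 1)`, gives `-log f`. The difference is `∑ g_k
/ (k x^k)`. Each `g_k` is nonnegative by Jensen (`degree_mul_pow_le_lapMatrix_pow`), so truncating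
at `c` gives the first bound (`eval_lapPoly_le`).

For spanning trees, `P_G(n) = det (L(Gᶜ) + J)`, with `J` all ones, is `n ^ 2` times a reduced
Laplacian determinant. Only one half of the matrix-tree theorem is needed: that determinant is at
least the number of trees (`numSpanningTrees_le_det`). -/

open Finset Matrix

/-! ### Rooted trees as parent functions -/

namespace SimpleGraph

/-- The graph joining every vertex `a ≠ r` to its parent `f a`. -/
def parentGraph {V : Type*} (r : V) (f : V → V) : SimpleGraph V :=
  SimpleGraph.fromRel fun a b => a ≠ r ∧ f a = b

theorem parentGraph_connected {V : Type*} {r : V} {f : V → V} {h : V → ℕ}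
    (hf : ∀ a, a ≠ r → h (f a) < h a) : (parentGraph r f).Connected := by
  have key : ∀ n a, h a = n → (parentGraph r f).Reachable r a := by
    intro n
    induction n using Nat.strong_induction_on with
    | _ n ih =>
      intro a ha
      by_cases har : a = r
      · subst har; exact Reachable.refl _
      · have hlt := hf a har
        refine (ih (h (f a)) (ha ▸ hlt) (f a) rfl).trans (Adj.reachable ?_)
        rw [parentGraph, fromRel_adj]
        refine ⟨fun e => ?_, Or.inr ⟨har, rfl⟩⟩
        rw [e] at hlt
        exact lt_irrefl _ hlt
  have : Nonempty V := ⟨r⟩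
  exact ⟨fun a b => (key _ a rfl).symm.trans (key _ b rfl)⟩

theorem parentGraph_le {V : Type*} {r : V} {f : V → V} {T : SimpleGraph V}
    (hf : ∀ a, a ≠ r → T.Adj a (f a)) : parentGraph r f ≤ T := by
  intro a b hab
  rw [parentGraph, fromRel_adj] at hab
  rcases hab.2 with ⟨h, rfl⟩ | ⟨h, rfl⟩
  · exact hf a h
  · exact (hf b h).symm

/-- A tree is a minimal connected graph, and it contains the connected parent graph. Hence the
parent function determines the tree. -/
theorem IsTree.eq_parentGraph {V : Type*} {r : V} {f : V → V} {T : SimpleGraph V}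
    (hT : T.IsTree) {h : V → ℕ} (hf : ∀ a, a ≠ r → T.Adj a (f a) ∧ h (f a) < h a) :
    T = parentGraph r f :=
  le_antisymm ((isTree_iff_minimal_connected.1 hT).le_of_le
    (parentGraph_connected fun a ha => (hf a ha).2) (parentGraph_le fun a ha => (hf a ha).1))
    (parentGraph_le fun a ha => (hf a ha).1)

theorem Connected.exists_adj_dist_lt {V : Type*} {T : SimpleGraph V} (hT : T.Connected)
    {a r : V} (h : a ≠ r) : ∃ b, T.Adj a b ∧ T.dist b r < T.dist a r := by
  obtain ⟨p, hp⟩ := hT.exists_walk_length_eq_dist a r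
  cases p with
  | nil => exact absurd rfl h
  | cons hab q =>
    refine ⟨_, hab, ?_⟩
    rw [← hp, Walk.length_cons]
    exact Nat.lt_succ_of_le (dist_le q)

end SimpleGraph

namespace GapBound

open SimpleGraph

variable {V : Type*} [Fintype V] [DecidableEq V]

/-! ### Half of the matrix-tree theorem -/

/-- The `a`-th row, for the parent `b`, of the matrix of a parent function rooted at `r`. -/
def parentRow (r a b : V) : V → ℝ :=
  if a = r then Pi.single r 1 else Pi.single a 1 - Pi.single b 1

theorem parentRow_mulVec (r : V) (f : V → V) (x : V → ℝ) (a : V) :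
    ((Matrix.of fun a => parentRow r a (f a)) *ᵥ x) a = if a = r then x r else x a - x (f a) := by
  change parentRow r a (f a) ⬝ᵥ x = _
  rw [parentRow]
  split_ifs
  · simp
  · rw [sub_dotProduct]
    simp

/-- Sorting vertices by `h` makes the matrix block triangular. No parent shares its child's level,
so the diagonal blocks are identities. -/
theorem det_parentRow_eq_one {r : V} {f : V → V} {h : V → ℕ}
    (hf : ∀ a, a ≠ r → h (f a) < h a) :
    (Matrix.of fun a => parentRow r a (f a)).det = 1 := by
  have hb : BlockTriangular (Matrix.of fun a => parentRow r a (f a)) (OrderDual.toDual ∘ h) := by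
    intro a b hab
    have hab' : h a < h b := hab
    have h1 : b ≠ a := by rintro rfl; exact lt_irrefl _ hab'
    by_cases har : a = r
    · subst har; simp [parentRow, h1]
    · have h2 : b ≠ f a := by rintro rfl; exact lt_asymm hab' (hf a har)
      simp [parentRow, har, h1, h2]
  rw [hb.det]
  refine Finset.prod_eq_one fun k _ => ?_
  convert Matrix.det_one (n := {a // (OrderDual.toDual ∘ h) a = k}) (R := ℝ)
  ext ⟨a, ha⟩ ⟨b, hbk⟩
  have hab : h a = h b := OrderDual.toDual.injective (ha.trans hbk.symm)
  simp only [toSquareBlock_def, of_apply, parentRow, Matrix.one_apply, Subtype.mk.injEq]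
  by_cases har : a = r
  · subst har; simp [Pi.single_apply, eq_comm]
  · have h2 : b ≠ f a := by rintro rfl; exact (hf a har).ne' hab
    simp [har, h2, Pi.single_apply, eq_comm]

theorem det_parentRow_nonneg (r : V) (f : V → V) :
    0 ≤ (Matrix.of fun a => parentRow r a (f a)).det := by
  classical
  by_cases hr : ∀ a, ∃ k, f^[k] a = r
  · refine (det_parentRow_eq_one (h := fun a => Nat.find (hr a)) fun a ha => ?_).symm ▸ zero_le_one
    have h1 := Nat.find_spec (hr a)
    rcases h2 : Nat.find (hr a) with _ | k
    · rw [h2] at h1; exact absurd h1 ha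
    · rw [h2, Function.iterate_succ_apply] at h1
      exact Nat.lt_succ_of_le (Nat.find_min' _ h1)
  · push Not at hr
    obtain ⟨a₀, ha₀⟩ := hr
    -- Some orbit misses `r`: the indicator of all such vertices is constant along `a ↦ f a` and
    -- zero at `r`, so it lies in the kernel.
    refine (exists_mulVec_eq_zero_iff.1
      ⟨fun a => if ∀ k, f^[k] a ≠ r then (1 : ℝ) else 0, fun h0 => ?_, ?_⟩).ge
    · have := congrFun h0 a₀
      simp [ha₀] at this
    · ext a
      rw [parentRow_mulVec]
      have hiff : a ≠ r → ((∀ k, f^[k] (f a) ≠ r) ↔ ∀ k, f^[k] a ≠ r) := by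
        refine fun ha => ⟨fun h k => ?_, fun h k => h (k + 1)⟩
        cases k with
        | zero => exact ha
        | succ k => exact h k
      split_ifs with h1 h2 h3 h4 h5 <;> first | exact absurd rfl (h2 0) | simp_all

/-- Row `a ≠ r` is the sum of `e_a - e_b` over neighbours `b`, so multilinearity expands the
determinant over parent functions. All terms are nonnegative, and distinct trees give distinct terms
equal to 1. -/
theorem numSpanningTrees_le_det (H : SimpleGraph V) [DecidableRel H.Adj] (r : V) :
    (numSpanningTrees H : ℝ) ≤ ((H.lapMatrix ℝ).updateRow r (Pi.single r 1)).det := by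
  classical
  set A : V → Finset V := fun a => if a = r then {r} else H.neighborFinset a with hA
  have hdet : ((H.lapMatrix ℝ).updateRow r (Pi.single r 1)).det =
      ∑ f ∈ Fintype.piFinset A, (Matrix.of fun a => parentRow r a (f a)).det := by
    have hrow : (H.lapMatrix ℝ).updateRow r (Pi.single r 1) =
        Matrix.of fun a => ∑ b ∈ A a, parentRow r a b := by
      ext a c
      by_cases har : a = r
      · subst har
        simp [hA, parentRow]
      · rw [updateRow_ne har]
        by_cases hac : a = c
        · subst hac
          simp [hA, har, parentRow, lapMatrix, degMatrix, Finset.sum_apply, Pi.single_apply]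
        · simp [hA, har, parentRow, lapMatrix, degMatrix, Finset.sum_apply, Pi.single_apply, hac,
            Ne.symm hac]
    rw [hrow]
    exact (detRowAlternating (n := V) (R := ℝ)).toMultilinearMap.map_sum_finset
      (fun a b => parentRow r a b) A
  have hpar : ∀ T : SimpleGraph V, ∃ f : V → V, f r = r ∧ (T.IsTree →
      ∀ a, a ≠ r → T.Adj a (f a) ∧ T.dist (f a) r < T.dist a r) := by
    intro T
    by_cases hT : T.IsTree
    · choose! f hf using fun a (ha : a ≠ r) => hT.connected.exists_adj_dist_lt ha
      -- The value at the root is pinned to `r` because `A r = {r}`.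
      refine ⟨Function.update f r r, by simp, fun _ a ha => ?_⟩
      rw [Function.update_of_ne ha]
      exact hf a ha
    · exact ⟨fun _ => r, rfl, fun h => absurd h hT⟩
  choose F hFr hF using hpar
  have hcard : numSpanningTrees H ≤ #{f ∈ Fintype.piFinset A |
      (Matrix.of fun a => parentRow r a (f a)).det = 1} := by
    rw [numSpanningTrees, Set.ncard_eq_toFinset_card']
    refine Finset.card_le_card_of_injOn F (fun T hT => ?_) fun T hT T' hT' hTT' => ?_
    · simp only [Set.coe_toFinset, Set.mem_ofPred_eq] at hT
      simp only [coe_filter, Fintype.mem_piFinset, Set.mem_ofPred_eq]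
      refine ⟨fun a => ?_, det_parentRow_eq_one (h := fun a => T.dist a r) fun a ha =>
        (hF T hT.2 a ha).2⟩
      by_cases ha : a = r
      · subst ha; simp [hA, hFr]
      · simpa [hA, ha] using hT.1 (hF T hT.2 a ha).1
    · simp only [Set.coe_toFinset, Set.mem_ofPred_eq] at hT hT'
      rw [hT.2.eq_parentGraph (h := fun a => T.dist a r) (hF T hT.2),
        hT'.2.eq_parentGraph (h := fun a => T'.dist a r) (hF T' hT'.2), hTT']
  rw [hdet]
  calc (numSpanningTrees H : ℝ) ≤ (#{f ∈ Fintype.piFinset A |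
      (Matrix.of fun a => parentRow r a (f a)).det = 1} : ℝ) := by exact_mod_cast hcard
    _ = ∑ f ∈ Fintype.piFinset A with (Matrix.of fun a => parentRow r a (f a)).det = 1,
        (Matrix.of fun a => parentRow r a (f a)).det := by
      rw [Finset.sum_congr rfl fun f hf => (Finset.mem_filter.1 hf).2]
      simp
    _ ≤ _ := Finset.sum_le_sum_of_subset_of_nonneg (Finset.filter_subset _ _)
      fun f _ _ => det_parentRow_nonneg r f

/-! ### The value of `P_G` at `n` -/

theorem det_updateRow_one_of_mulVec_one_eq_zero {L : Matrix V V ℝ} (hL : L *ᵥ 1 = 0) (r : V) :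
    (L.updateRow r 1).det = Fintype.card V * (L.updateRow r (Pi.single r 1)).det := by
  have hj : ∀ j, (L.updateRow r (Pi.single j 1)).det = (L.updateRow r (Pi.single r 1)).det := by
    intro j
    -- With row `r` equal to `e_j - e_r`, every row annihilates the all-ones vector.
    have h0 : (L.updateRow r (Pi.single j 1 - Pi.single r 1)).det = 0 := by
      refine exists_mulVec_eq_zero_iff.1 ⟨1, fun h => one_ne_zero (congrFun h r), ?_⟩
      ext a
      by_cases ha : a = r
      · subst ha
        change updateRow L a _ a ⬝ᵥ 1 = 0
        rw [updateRow_self, sub_dotProduct]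
        simp
      · simpa [mulVec, updateRow_ne ha] using congrFun hL a
    rw [sub_eq_add_neg, det_updateRow_add, ← neg_one_smul ℝ (Pi.single r (1 : ℝ) : V → ℝ),
      det_updateRow_smul] at h0
    linarith
  have h1 : (1 : V → ℝ) = ∑ j, Pi.single j (1 : ℝ) := (Finset.univ_sum_single 1).symm
  have h2 := (detRowAlternating (n := V) (R := ℝ)).toMultilinearMap.map_update_sum
    Finset.univ r (fun j => Pi.single j (1 : ℝ)) L
  rw [h1]
  refine h2.trans ((Finset.sum_congr rfl fun j _ => hj j).trans ?_)
  simp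

/-- Adding all rows to row `r` turns it into `n • 1`, since the columns of `L` sum to zero.
Subtracting the row `1` from the others removes the ones, and the second factor `n` comes from the
previous lemma. -/
theorem det_add_ones_eq {L : Matrix V V ℝ} (hL : L *ᵥ 1 = 0) (hs : L.IsSymm) (r : V) :
    (L + Matrix.of fun _ _ => 1).det =
      (Fintype.card V : ℝ) ^ 2 * (L.updateRow r (Pi.single r 1)).det := by
  have h1 := det_updateRow_sum (L + Matrix.of fun _ _ => 1) r (fun _ => (1 : ℝ))
  have hsum : ∑ k, (1 : ℝ) • (L + Matrix.of fun _ _ => 1 : Matrix V V ℝ) k = (Fintype.card V : ℝ) • 1 := by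
    ext j
    have := congrFun hL j
    simp only [mulVec, dotProduct, Pi.one_apply, mul_one, Pi.zero_apply] at this
    simp only [← hs.apply j] at this
    refine (Finset.sum_apply j _ _).trans ?_
    simp [Finset.sum_add_distrib, this]
  rw [hsum, det_updateRow_smul, one_smul] at h1
  have h2 : ((L + Matrix.of fun _ _ => 1).updateRow r 1).det = (L.updateRow r 1).det := by
    refine det_eq_of_forall_row_eq_smul_add_const (fun a => if a = r then 0 else 1) r (by simp) ?_
    intro a b
    by_cases ha : a = r
    · subst ha; simp
    · simp [ha]
  rw [← h1, h2, det_updateRow_one_of_mulVec_one_eq_zero hL]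
  ring

theorem lapMatrix_compl (G : SimpleGraph V) [DecidableRel G.Adj] :
    (Fintype.card V : ℝ) • (1 : Matrix V V ℝ) - G.lapMatrix ℝ =
      Gᶜ.lapMatrix ℝ + Matrix.of fun _ _ => 1 := by
  ext a b
  by_cases h : a = b
  · subst h
    have h1 := G.degree_compl (v := a)
    have h2 := G.degree_lt_card_verts a
    have h3 : (Gᶜ.degree a : ℝ) = Fintype.card V - 1 - G.degree a := by
      rw [h1, Nat.cast_sub (by omega), Nat.cast_sub (by omega)]; simp
    simp [lapMatrix, degMatrix, h3]
    ring
  · by_cases hG : G.Adj a b <;> simp [lapMatrix, degMatrix, h, hG]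

theorem eval_card_lapPoly (G : SimpleGraph V) [DecidableRel G.Adj] (r : V) :
    (lapPoly G).eval (Fintype.card V : ℝ) =
      (Fintype.card V : ℝ) ^ 2 * ((Gᶜ.lapMatrix ℝ).updateRow r (Pi.single r 1)).det := by
  rw [lapPoly, eval_charpoly, ← det_add_ones_eq Gᶜ.lapMatrix_mulVec_const_eq_zero
    (Gᶜ.isSymm_lapMatrix (R := ℝ)) r, ← lapMatrix_compl, scalar_apply, smul_one_eq_diagonal]

/-! ### Spectrum and nonnegativity of the gap sequence -/

theorem lap_eigenvalues_lt_card {G : SimpleGraph V} [DecidableRel G.Adj] (hG : Gᶜ.Connected)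
    (j : V) : (G.isHermitian_lapMatrix ℝ).eigenvalues j < Fintype.card V := by
  set hL := G.isHermitian_lapMatrix ℝ
  by_contra! hle
  set u : V → ℝ := ⇑(hL.eigenvectorBasis j) with hu
  have hLu : G.lapMatrix ℝ *ᵥ u = hL.eigenvalues j • u := hL.mulVec_eigenvectorBasis j
  have hu0 : u ≠ 0 := by
    intro h
    apply hL.eigenvectorBasis.orthonormal.ne_zero j
    ext a
    exact congrFun h a
  have hpos : 0 < u ⬝ᵥ u := by
    have := dotProduct_self_star_pos_iff.2 hu0
    simpa using this
  have hform : u ⬝ᵥ ((Gᶜ.lapMatrix ℝ) *ᵥ u) =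
      (Fintype.card V - hL.eigenvalues j) * (u ⬝ᵥ u) - (∑ a, u a) ^ 2 := by
    have h1 : (Matrix.of fun _ _ => (1 : ℝ)) *ᵥ u = fun _ : V => ∑ a, u a := by
      ext a; simp [mulVec, dotProduct]
    rw [eq_sub_of_add_eq (lapMatrix_compl G).symm, sub_mulVec, sub_mulVec, hLu, h1, smul_mulVec,
      one_mulVec, dotProduct_sub, dotProduct_sub, dotProduct_smul, dotProduct_smul]
    simp only [dotProduct, smul_eq_mul, ← Finset.sum_mul]
    ring
  have hnn : 0 ≤ u ⬝ᵥ ((Gᶜ.lapMatrix ℝ) *ᵥ u) := by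
    simpa using (posSemidef_lapMatrix ℝ Gᶜ).dotProduct_mulVec_nonneg u
  have hmul : (Fintype.card V - hL.eigenvalues j) * (u ⬝ᵥ u) ≤ 0 :=
    mul_nonpos_of_nonpos_of_nonneg (by linarith) hpos.le
  -- The form is nonnegative, yet by `hform` it is a sum of two nonpositive terms, so everything
  -- vanishes. Connectedness then makes `u` constant with sum zero, hence zero.
  have hs : ∑ a, u a = 0 := by nlinarith [sq_nonneg (∑ a, u a)]
  have h0 : u ⬝ᵥ ((Gᶜ.lapMatrix ℝ) *ᵥ u) = 0 := by nlinarith [sq_nonneg (∑ a, u a)]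
  rw [← toLinearMap₂'_apply', lapMatrix_toLinearMap₂'_apply'_eq_zero_iff_forall_reachable] at h0
  apply hu0
  ext a
  have hc : ∑ b, u b = Fintype.card V * u a := by
    rw [Finset.sum_congr rfl fun b _ => h0 b a (hG.preconnected b a)]; simp
  have hn : (Fintype.card V : ℝ) ≠ 0 := by
    have : Nonempty V := ⟨a⟩
    simp
  rw [hs] at hc
  simpa [hn] using hc.symm

theorem pow_eq_conj_diagonal {L : Matrix V V ℝ} (hL : L.IsHermitian) (k : ℕ) :
    L ^ k = (hL.eigenvectorUnitary : Matrix V V ℝ) * diagonal (fun j => hL.eigenvalues j ^ k) *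
      star (hL.eigenvectorUnitary : Matrix V V ℝ) := by
  conv_lhs => rw [hL.spectral_theorem, ← map_pow, Unitary.conjStarAlgAut_apply, diagonal_pow]
  rfl

theorem pow_apply_self_eq_sum_eigenvalues {L : Matrix V V ℝ} (hL : L.IsHermitian) (k : ℕ) (i : V) :
    (L ^ k) i i = ∑ j, hL.eigenvalues j ^ k * (hL.eigenvectorUnitary : Matrix V V ℝ) i j ^ 2 := by
  rw [pow_eq_conj_diagonal hL, Matrix.mul_apply]
  refine Finset.sum_congr rfl fun j _ => ?_
  simp [mul_diagonal, star_apply]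
  ring

theorem trace_pow_eq_sum_eigenvalues {L : Matrix V V ℝ} (hL : L.IsHermitian) (k : ℕ) :
    (L ^ k).trace = ∑ j, hL.eigenvalues j ^ k := by
  rw [pow_eq_conj_diagonal hL, trace_mul_cycle, ← Unitary.coe_star]
  simp [trace]

theorem lapMatrix_apply_self (G : SimpleGraph V) [DecidableRel G.Adj] (i : V) :
    G.lapMatrix ℝ i i = G.degree i := by
  simp [lapMatrix, degMatrix]

theorem lapMatrix_sq_apply_self (G : SimpleGraph V) [DecidableRel G.Adj] (i : V) :
    (G.lapMatrix ℝ ^ 2) i i = (G.degree i : ℝ) * (G.degree i + 1) := by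
  have hA := G.adjMatrix_mul_self_apply_self (α := ℝ) i
  have h : (G.lapMatrix ℝ ^ 2) i i =
      (G.degree i : ℝ) * G.degree i + (G.adjMatrix ℝ * G.adjMatrix ℝ) i i := by
    rw [pow_two, lapMatrix, sub_mul, mul_sub, mul_sub, degMatrix]
    simp only [Matrix.sub_apply, diagonal_mul, mul_diagonal, diagonal_apply_eq]
    simp [-adjMatrix_mul_apply, -mul_adjMatrix_apply]
  rw [h, hA]
  ring

/-- Jensen for `t ↦ t ^ k` with weights `μ_j u_j ^ 2 / d_i`. They sum to 1 because `L_ii = d_i`, and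
their mean is `d_i + 1` because `(L ^ 2)_ii = d_i (d_i + 1)`. -/
theorem degree_mul_pow_le_lapMatrix_pow (G : SimpleGraph V) [DecidableRel G.Adj] (k : ℕ) (i : V) :
    (G.degree i : ℝ) * ((G.degree i : ℝ) + 1) ^ k ≤ (G.lapMatrix ℝ ^ (k + 1)) i i := by
  have hL := G.isHermitian_lapMatrix ℝ
  have hev : ∀ j, 0 ≤ hL.eigenvalues j := (posSemidef_lapMatrix ℝ G).eigenvalues_nonneg
  set u : V → ℝ := fun j => (hL.eigenvectorUnitary : Matrix V V ℝ) i j with hu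
  have hp : ∀ m, (G.lapMatrix ℝ ^ m) i i = ∑ j, hL.eigenvalues j ^ m * u j ^ 2 :=
    fun m => pow_apply_self_eq_sum_eigenvalues hL m i
  rcases (Nat.cast_nonneg (α := ℝ) (G.degree i)).eq_or_lt with hd | hd
  · rw [← hd, zero_mul, hp]
    exact Finset.sum_nonneg fun j _ => mul_nonneg (pow_nonneg (hev j) _) (sq_nonneg _)
  · have h1 := hp 1
    rw [pow_one, lapMatrix_apply_self] at h1
    have h2 := hp 2
    rw [lapMatrix_sq_apply_self] at h2
    have hJ := Real.pow_arith_mean_le_arith_mean_pow Finset.univ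
      (fun j => hL.eigenvalues j * u j ^ 2 / G.degree i) hL.eigenvalues
      (fun j _ => div_nonneg (mul_nonneg (hev j) (sq_nonneg _)) hd.le)
      (by rw [← Finset.sum_div, div_eq_one_iff_eq hd.ne', h1]; simp) (fun j _ => hev j) k
    have e1 : ∑ j, hL.eigenvalues j * u j ^ 2 / G.degree i * hL.eigenvalues j =
        (G.degree i : ℝ) + 1 := by
      rw [eq_comm, ← mul_right_inj' hd.ne', h2, Finset.mul_sum]
      exact Finset.sum_congr rfl fun j _ => by field_simp
    have e2 : (G.degree i : ℝ) * ∑ j, hL.eigenvalues j * u j ^ 2 / G.degree i *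
        hL.eigenvalues j ^ k = (G.lapMatrix ℝ ^ (k + 1)) i i := by
      rw [hp, Finset.mul_sum]
      exact Finset.sum_congr rfl fun j _ => by field_simp; ring
    rw [e1] at hJ
    rw [← e2]
    exact mul_le_mul_of_nonneg_left hJ hd.le

theorem gapSeq_nonneg (G : SimpleGraph V) [DecidableRel G.Adj] (k : ℕ) :
    0 ≤ gapSeq G (k + 1) := by
  rw [gapSeq, lapSeq, trace, ← Finset.sum_sub_distrib]
  exact Finset.sum_nonneg fun i _ => sub_nonneg.2 (degree_mul_pow_le_lapMatrix_pow G k i)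

/-! ### Logarithm series and the bound -/

theorem degree_eq_zero_or_succ_lt_card {G : SimpleGraph V} [DecidableRel G.Adj]
    (hG : Gᶜ.Connected) (i : V) : G.degree i = 0 ∨ G.degree i + 1 < Fintype.card V := by
  have h2 := G.degree_lt_card_verts i
  rcases subsingleton_or_nontrivial V with hV | hV
  · have := Fintype.card_le_one_iff_subsingleton.2 hV
    omega
  · have h1 := G.degree_compl (v := i)
    have h3 := hG.preconnected.degree_pos_of_nontrivial i
    omega

theorem hasSum_neg_log_one_sub_div {a x : ℝ} (ha : 0 ≤ a) (hax : a < x) :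
    HasSum (fun k : ℕ => a ^ (k + 1) / (((k + 1 : ℕ) : ℝ) * x ^ (k + 1)))
      (-Real.log (1 - a / x)) := by
  have hx : 0 < x := ha.trans_lt hax
  have h : |a / x| < 1 := by
    rw [abs_of_nonneg (div_nonneg ha hx.le), div_lt_one hx]; exact hax
  convert Real.hasSum_pow_div_log_of_abs_lt_one h using 2 with k
  rw [div_pow]
  push_cast
  field_simp

theorem hasSum_lapSeq {G : SimpleGraph V} [DecidableRel G.Adj] (hG : Gᶜ.Connected) {x : ℝ}
    (hx : (Fintype.card V : ℝ) ≤ x) :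
    HasSum (fun k : ℕ => lapSeq G (k + 1) / (((k + 1 : ℕ) : ℝ) * x ^ (k + 1)))
      (-Real.log (∏ j, (1 - (G.isHermitian_lapMatrix ℝ).eigenvalues j / x))) := by
  have hL := G.isHermitian_lapMatrix ℝ
  have hev : ∀ j, 0 ≤ hL.eigenvalues j := (posSemidef_lapMatrix ℝ G).eigenvalues_nonneg
  have hlt : ∀ j, hL.eigenvalues j < x := fun j => (lap_eigenvalues_lt_card hG j).trans_le hx
  rw [Real.log_prod fun j _ => (sub_pos.2
    ((div_lt_one ((hev j).trans_lt (hlt j))).2 (hlt j))).ne', ← Finset.sum_neg_distrib]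
  simp only [lapSeq, trace_pow_eq_sum_eigenvalues hL, Finset.sum_div]
  exact hasSum_sum fun j _ => hasSum_neg_log_one_sub_div (hev j) (hlt j)

theorem hasSum_degree {G : SimpleGraph V} [DecidableRel G.Adj] (hG : Gᶜ.Connected) {x : ℝ}
    (hx : (Fintype.card V : ℝ) ≤ x) :
    HasSum (fun k : ℕ => (∑ v, (G.degree v : ℝ) * ((G.degree v : ℝ) + 1) ^ k) /
        (((k + 1 : ℕ) : ℝ) * x ^ (k + 1)))
      (-∑ v, (G.degree v : ℝ) / (G.degree v + 1) * Real.log (1 - (G.degree v + 1) / x)) := by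
  simp only [Finset.sum_div, ← Finset.sum_neg_distrib]
  refine hasSum_sum fun v _ => ?_
  rcases degree_eq_zero_or_succ_lt_card hG v with h | h
  · simp [h, hasSum_zero]
  · have hlt : (G.degree v : ℝ) + 1 < x := lt_of_lt_of_le (by exact_mod_cast h) hx
    have hpos : (0 : ℝ) < G.degree v + 1 := by positivity
    rw [← mul_neg]
    have hs := (hasSum_neg_log_one_sub_div hpos.le hlt).mul_left
      ((G.degree v : ℝ) / (G.degree v + 1))
    refine (congrArg (HasSum · _) (funext fun k => ?_)).mpr hs
    rw [pow_succ ((G.degree v : ℝ) + 1)]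
    field_simp

theorem degProd_eq_exp {G : SimpleGraph V} [DecidableRel G.Adj] (hG : Gᶜ.Connected) {x : ℝ}
    (hx : (Fintype.card V : ℝ) ≤ x) :
    degProd (fun v => G.degree v) x =
      Real.exp (∑ v, (G.degree v : ℝ) / (G.degree v + 1) *
        Real.log (1 - (G.degree v + 1) / x)) := by
  rw [degProd, Real.exp_sum]
  refine Finset.prod_congr rfl fun v _ => ?_
  rcases degree_eq_zero_or_succ_lt_card hG v with h | h
  -- The exponent 0 also covers `x = n = 1`, where the base is 0.
  · simp [h]
  · have hlt : (G.degree v : ℝ) + 1 < x := lt_of_lt_of_le (by exact_mod_cast h) hx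
    have hpos : (0 : ℝ) < x := lt_trans (by positivity) hlt
    rw [Real.rpow_def_of_pos (sub_pos.2 ((div_lt_one hpos).2 hlt)), mul_comm]

theorem eval_lapPoly_le {G : SimpleGraph V} [DecidableRel G.Adj] (hG : Gᶜ.Connected) (c : ℕ)
    {x : ℝ} (hx : (Fintype.card V : ℝ) ≤ x) :
    (lapPoly G).eval x ≤ x ^ Fintype.card V *
      Real.exp (-∑ k ∈ Finset.Icc 1 c, gapSeq G k / ((k : ℝ) * x ^ k)) *
      degProd (fun v => G.degree v) x := by
  have hL := G.isHermitian_lapMatrix ℝ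
  have : Nonempty V := hG.nonempty
  have hx0 : 0 < x := lt_of_lt_of_le (by exact_mod_cast Fintype.card_pos) hx
  have hprod : 0 < ∏ j, (1 - hL.eigenvalues j / x) := Finset.prod_pos fun j _ =>
    sub_pos.2 ((div_lt_one hx0).2 ((lap_eigenvalues_lt_card hG j).trans_le hx))
  have heval : (lapPoly G).eval x = x ^ Fintype.card V * ∏ j, (1 - hL.eigenvalues j / x) := by
    rw [lapPoly, hL.charpoly_eq, Polynomial.eval_prod, ← Finset.card_univ, ← Finset.prod_const,
      ← Finset.prod_mul_distrib]
    refine Finset.prod_congr rfl fun j _ => ?_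
    simp
    field_simp
  have hsum : HasSum (fun k : ℕ => gapSeq G (k + 1) / (((k + 1 : ℕ) : ℝ) * x ^ (k + 1)))
      (-Real.log (∏ j, (1 - hL.eigenvalues j / x)) -
        -∑ v, (G.degree v : ℝ) / (G.degree v + 1) * Real.log (1 - (G.degree v + 1) / x)) := by
    simpa only [gapSeq, sub_div, Nat.add_sub_cancel] using
      (hasSum_lapSeq hG hx).sub (hasSum_degree hG hx)
  -- Dropping the nonnegative tail is the only loss.
  have hle := sum_le_hasSum (Finset.range c) (fun k _ => div_nonneg (gapSeq_nonneg G k)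
    (by positivity)) hsum
  rw [Finset.range_eq_Ico, Finset.sum_Ico_add' (fun k : ℕ => gapSeq G k / ((k : ℝ) * x ^ k)),
    zero_add, Finset.Ico_add_one_right_eq_Icc] at hle
  rw [heval, degProd_eq_exp hG hx, mul_assoc, ← Real.exp_add]
  refine mul_le_mul_of_nonneg_left ?_ (by positivity)
  rw [← Real.log_le_iff_le_exp hprod]
  linarith

end GapBound

theorem lemma4p1 {V : Type*} [Fintype V] [DecidableEq V]
    (G : SimpleGraph V) [DecidableRel G.Adj] (hG : Gᶜ.Connected) (c : ℕ) (hc : 1 ≤ c) :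
    (∀ x : ℝ, (Fintype.card V : ℝ) ≤ x →
      (GapBound.lapPoly G).eval x ≤
        x ^ Fintype.card V
          * Real.exp (-∑ k ∈ Finset.Icc 1 c, GapBound.gapSeq G k / ((k : ℝ) * x ^ k))
          * GapBound.degProd (fun v => G.degree v) x) ∧
    (GapBound.numSpanningTrees Gᶜ : ℝ) ≤
      (Fintype.card V : ℝ) ^ ((Fintype.card V : ℤ) - 2)
        * Real.exp (-∑ k ∈ Finset.Icc 1 c,
            GapBound.gapSeq G k / ((k : ℝ) * (Fintype.card V : ℝ) ^ k))
        * GapBound.degProd (fun v => G.degree v) (Fintype.card V : ℝ) := by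
  refine ⟨fun x hx => GapBound.eval_lapPoly_le hG c hx, ?_⟩
  obtain ⟨r⟩ := hG.nonempty
  have : Nonempty V := ⟨r⟩
  have hn : (0 : ℝ) < Fintype.card V := by exact_mod_cast Fintype.card_pos
  have h1 := GapBound.eval_lapPoly_le hG c le_rfl
  rw [GapBound.eval_card_lapPoly G r, mul_comm, ← le_div_iff₀ (by positivity)] at h1
  refine (GapBound.numSpanningTrees_le_det Gᶜ r).trans (h1.trans_eq ?_)
  -- The exponent `n - 2` is an integer, so `n = 1` needs no separate case.
  rw [zpow_sub₀ hn.ne', zpow_natCast, zpow_ofNat]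
  ring
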